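/- Let $d\in\mathbb N$, let $Z$ be a Banach space, $\sigma\ge 0$ and $0<\beta\le 1$. Let $F:[0,\infty)\times Z\to Z$ be continuous and locally Lipschitz in the second variable: for all $R,T>0$ there is $L>0$ such that $|F(t,z)-F(t,\tilde z)|_Z\le L|z-\tilde z|_Z$ whenever $t\in[0,T]$ and $|z|_Z,|\tilde z|_Z\le R$. Let $C_u(\mathbb R^d,Z)$ be the Banach space of bounded uniformly continuous functions $\mathbb R^d\to Z$ with the supremum norm, and let $C_0(\mathbb R^d,Z)$ be the subspace of those $w$ with $w(x)\to0$ as $|x|\to\infty$. Let $g_\beta(x)=(2\pi)^{-d}\int_{\mathbb R^d}e^{i x\cdot\xi}e^{-|\xi|^{2\beta}}\,d\xi$ and $G_{\sigma,\beta}(t,x)=(\sigma t)^{-d/(2\beta)}g_\beta\big((\sigma t)^{-1/(2\beta)}x\big)$ for $\sigma t>0$. Let $S(t)w=G_{\sigma,\beta}(t,\cdot)*w$ if $\sigma t>0$, and $S(t)w=w$ if $\sigma t=0$; this is the semigroup generated by $-\sigma(-\Delta)^\beta$. A mild solution of $\partial_tu+\sigma(-\Delta)^\beta u=F(t,u)$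 with initial value $u_0\in C_u(\mathbb R^d,Z)$ on an interval $I=[0,T]$ or $I=[0,T)$ is a function $u\in C(I,C_u(\mathbb R^d,Z))$ such that $$u(t)=S(t)u_0+\int_0^tS(t-t')F(t',u(t'))\,dt'\qquad(t\in I),$$ where $F(t',w)(x)=F(t',w(x))$ and the integral is taken at each point $x\in\mathbb R^d$ as a Bochner integral in $Z$. Let $T^*(u_0)\in[0,\infty]$ be the supremum of the $T\ge0$ for which there is a mild solution on $[0,T]$ with initial value $u_0$. Let $u_0,\tilde u_0\in C_u(\mathbb R^d,Z)$ with $u_0-\tilde u_0\in C_0(\mathbb R^d,Z)$, and let $u,\tilde u$ be mild solutions with initial values $u_0,\tilde u_0$ on $[0,T^*(u_0))$ and $[0,T^*(\tilde u_0))$ respectively. Then $u(t)-\tilde u(t)\in C_0(\mathbb R^d,Z)$ for every $0\le t<\min\{T^*(u_0),T^*(\tilde u_0)\}$. -/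

import Mathlib

namespace FracRD

open scoped FourierTransform BoundedContinuousFunction ENNReal

noncomputable section

/-- The Euclidean space `ℝ^d`. -/
abbrev Space (d : ℕ) : Type := EuclideanSpace ℝ (Fin d)

/-- `C_u(ℝ^d, Z)`: bounded uniformly continuous functions `ℝ^d → Z`, a subspace of the bounded
continuous functions and so normed by `‖u‖ = sup_x |u(x)|`. -/
def Cu (d : ℕ) (Z : Type*) [NormedAddCommGroup Z] [NormedSpace ℝ Z] :
    Submodule ℝ (Space d →ᵇ Z) where
  carrier := {u | UniformContinuous u}
  add_mem' := fun {_ _} hu hv => UniformContinuous.add hu hv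
  zero_mem' := uniformContinuous_const
  smul_mem' := fun c _ hu => UniformContinuous.const_smul hu c

/-- `u ∈ C_0(ℝ^d, Z)` for `u ∈ C_u(ℝ^d, Z)`: `u(x) → 0` as `|x| → ∞`. -/
def VanishesAtInfinity {d : ℕ} {Z : Type*} [NormedAddCommGroup Z] [NormedSpace ℝ Z]
    (u : Cu d Z) : Prop :=
  Filter.Tendsto (fun x : Space d => u.1 x) (Bornology.cobounded (Space d)) (nhds 0)

/-- The profile `g_β`, with `∫ exp (-i ⟨x, ξ⟩) g_β(x) dx = exp (-|ξ|^(2β))`, that is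
`g_β(x) = (2π)^(-d) ∫ exp (i ⟨x, ξ⟩) exp (-|ξ|^(2β)) dξ`.  Mathlib's inverse Fourier integral has
the kernel `exp (2π i ⟨x, η⟩)`, whence the substitution `ξ = 2π η`.  The integral is real because
the symbol is even. -/
def profile (d : ℕ) (β : ℝ) (x : Space d) : ℝ :=
  (𝓕⁻ (fun η : Space d => ((Real.exp (-‖(2 * Real.pi) • η‖ ^ (2 * β)) : ℝ) : ℂ)) x).re

/-- Green's function `G_{σ,β}(t, x) = (σ t)^(-d/(2β)) g_β((σ t)^(-1/(2β)) x)`, for `σ t > 0`. -/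
def green (d : ℕ) (σ β t : ℝ) (x : Space d) : ℝ :=
  (σ * t) ^ (-(d : ℝ) / (2 * β)) * profile d β ((σ * t) ^ (-1 / (2 * β)) • x)

open Classical in
/-- The semigroup `S(t)` generated by `-σ(-Δ)^β`: `S(t) u = G_{σ,β}(t, ·) * u` if `σ t > 0`, and
the identity if `t = 0` or `σ = 0`. -/
def semigroup {d : ℕ} {Z : Type*} [NormedAddCommGroup Z] [NormedSpace ℝ Z]
    (σ β t : ℝ) (u : Space d → Z) (x : Space d) : Z :=
  if σ * t = 0 then u x else ∫ y, green d σ β t y • u (x - y)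

/-- Local Lipschitz continuity of `F : [0, ∞) × Z → Z` in the second variable, uniform on
bounded sets of times and of points. -/
def LocallyLipschitzSnd {Z : Type*} [NormedAddCommGroup Z] (F : ℝ → Z → Z) : Prop :=
  ∀ R > 0, ∀ T > 0, ∃ L > 0, ∀ t ∈ Set.Icc (0 : ℝ) T, ∀ z z' : Z, ‖z‖ ≤ R → ‖z'‖ ≤ R →
    ‖F t z - F t z'‖ ≤ L * ‖z - z'‖

/-- `u` is a mild solution of `∂ₜ u + σ(-Δ)^β u = F(t, u)`, `u(0) = u₀`, on the interval `I`
(of the form `[0, T]` or `[0, T)`): `u ∈ C(I, C_u(ℝ^d, Z))` and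
`u(t) = S(t) u₀ + ∫_0^t S(t - s) F(s, u(s)) ds` for `t ∈ I`.
The identity between functions on `ℝ^d` is written at each point `x`, with a Bochner integral
in `Z`.  Evaluation at `x` being continuous and linear, it follows from the same identity with a
Bochner integral in `C_u(ℝ^d, Z)` whenever the latter integral exists. -/
def IsMildSolutionOn {d : ℕ} {Z : Type*} [NormedAddCommGroup Z] [NormedSpace ℝ Z]
    (σ β : ℝ) (F : ℝ → Z → Z) (u₀ : Cu d Z) (I : Set ℝ) (u : ℝ → Cu d Z) : Prop :=
  ContinuousOn u I ∧
  ∀ t ∈ I, ∀ x : Space d,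
    (u t).1 x = semigroup σ β t u₀.1 x +
      ∫ s in (0 : ℝ)..t, semigroup σ β (t - s) (fun y => F s ((u s).1 y)) x

/-- The maximal existence time `T*(u₀) ∈ [0, ∞]`: the supremum of the `T ≥ 0` for which there is
a mild solution on `[0, T]` with initial value `u₀`. -/
def maximalTime {d : ℕ} {Z : Type*} [NormedAddCommGroup Z] [NormedSpace ℝ Z]
    (σ β : ℝ) (F : ℝ → Z → Z) (u₀ : Cu d Z) : ℝ≥0∞ :=
  sSup (ENNReal.ofReal ''
    {T : ℝ | 0 ≤ T ∧ ∃ u : ℝ → Cu d Z, IsMildSolutionOn σ β F u₀ (Set.Icc 0 T) u})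

/-- The half-open interval `[0, T)`, where `T ∈ [0, ∞]`. -/
def timeInterval (T : ℝ≥0∞) : Set ℝ := {t | 0 ≤ t ∧ ENNReal.ofReal t < T}

end

end FracRD

/-! The idea is to bound the limsup of `‖u(s) - v(s)‖` as `|x| → ∞` by a Gronwall argument with a
weight. Suppose the limsup is at most `M e^{2Ls}` on `[0, T]`, with `L` a Lipschitz constant of `F`
on a ball containing all values of both solutions. The Duhamel formula bounds it at time `t` by
`∫_0^t L M e^{2Ls} ds ≤ (M/2) e^{2Lt}`, the term `S(t)(u₀ - v₀)` contributing nothing. Iterating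
this halving (`limsupNormLE_sub_of_mild`) from the sup bound forces the limsup to be zero. The
maximal times enter only because `[0, t]` lies in both existence intervals.

This requires that `S(t)` does not increase a bound on the limsup at infinity
(`LimsupNormLE.semigroup`), which holds once Green's function has `L¹` norm at most one. For that,
`g_β` is shown to be nonnegative with mass at most one. Nonnegativity is subordination: `r^β` is a
positive multiple of `∫_0^∞ (1 - e^{-sr}) s^{-1-β} ds` when `β < 1`, so `e^{-κ r^β}` with `r = |η|²`
is a limit of positive mixtures of Gaussians, whose Fourier transforms are nonnegative
(`isPosDef_exp_neg_mul_rpow`). The mass bound follows by testing `g_β` against wide Gaussians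
(`integral_profile_mul_exp_le_one`) and applying Fatou's lemma. -/

namespace FracRD

open MeasureTheory Filter Topology Real
open scoped FourierTransform BoundedContinuousFunction ENNReal RealInnerProductSpace

/-! ### Radial functions with nonnegative Fourier transform -/

section PositiveDefinite

variable {E : Type*} [NormedAddCommGroup E] [InnerProductSpace ℝ E] [FiniteDimensional ℝ E]
  [MeasurableSpace E] [BorelSpace E]

theorem integrable_exp_neg_mul_norm_sq {δ : ℝ} (hδ : 0 < δ) :
    Integrable (fun η : E => exp (-δ * ‖η‖ ^ 2)) := by
  refine Integrable.of_integral_ne_zero ?_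
  rw [GaussianFourier.integral_rexp_neg_mul_sq_norm hδ]
  positivity

theorem integral_exp_neg_mul_norm_sq_mul_cos {δ : ℝ} (hδ : 0 < δ) (x : E) :
    ∫ η : E, exp (-δ * ‖η‖ ^ 2) * cos (2 * π * ⟪η, x⟫) =
      (π / δ) ^ (Module.finrank ℝ E / 2 : ℝ) * exp (-π ^ 2 * ‖x‖ ^ 2 / δ) := by
  have h := fourier_gaussian_innerProductSpace (V := E) (b := (δ : ℂ)) (by simpa using hδ) x
  rw [Real.fourier_eq'] at h
  have hR : ((π / δ : ℂ)) ^ (Module.finrank ℝ E / 2 : ℂ) * Complex.exp (-π ^ 2 * ‖x‖ ^ 2 / δ) =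
      (((π / δ) ^ (Module.finrank ℝ E / 2 : ℝ) * exp (-π ^ 2 * ‖x‖ ^ 2 / δ) : ℝ) : ℂ) := by
    push_cast
    rw [Complex.ofReal_cpow (by positivity)]
    push_cast
    rfl
  rw [hR] at h
  have hint : Integrable (fun v : E => Complex.exp (((-2 * π * ⟪v, x⟫ : ℝ) : ℂ) * Complex.I) •
      Complex.exp (-(δ : ℂ) * (‖v‖ : ℂ) ^ 2)) := by
    refine (integrable_exp_neg_mul_norm_sq (E := E) hδ).mono' (by fun_prop) ?_
    refine Eventually.of_forall fun v => le_of_eq ?_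
    rw [norm_smul, Complex.norm_exp_ofReal_mul_I, one_mul, Complex.norm_exp]
    congr 1
    rw [← Complex.ofReal_pow, ← Complex.ofReal_neg, ← Complex.ofReal_mul, Complex.ofReal_re]
  have h2 := congrArg Complex.re h
  rw [Complex.ofReal_re] at h2
  rw [← h2, ← RCLike.re_eq_complex_re, ← integral_re hint]
  congr 1 with v
  rw [RCLike.re_eq_complex_re, smul_eq_mul]
  have : Complex.exp (-(δ : ℂ) * (‖v‖ : ℂ) ^ 2) = ((exp (-δ * ‖v‖ ^ 2) : ℝ) : ℂ) := by
    push_cast; rfl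
  rw [this, Complex.re_mul_ofReal, Complex.exp_ofReal_mul_I_re, mul_comm]
  congr 1
  rw [← Real.cos_neg]
  ring_nf

variable (E) in
/-- `φ(‖·‖²)` is bounded, measurable on `E`, and all its Gaussian regularizations have a
nonnegative Fourier transform. -/
structure IsPosDef (φ : ℝ → ℝ) : Prop where
  measurable : Measurable φ
  bounded : ∃ B : ℝ, ∀ r, 0 ≤ r → |φ r| ≤ B
  nonneg : ∀ δ : ℝ, 0 < δ → ∀ x : E,
    0 ≤ ∫ η : E, φ (‖η‖ ^ 2) * (exp (-δ * ‖η‖ ^ 2) * cos (2 * π * ⟪η, x⟫))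

theorem abs_mul_exp_mul_cos_le {B c δ r θ : ℝ} (h : |c| ≤ B) :
    ‖c * (exp (-δ * r) * cos θ)‖ ≤ B * exp (-δ * r) := by
  rw [norm_mul, norm_mul, Real.norm_eq_abs, Real.norm_eq_abs, abs_exp]
  exact mul_le_mul h (mul_le_of_le_one_right (exp_pos _).le (abs_cos_le_one θ)) (by positivity)
    ((abs_nonneg c).trans h)

theorem integrable_mul_exp_mul_cos {φ : ℝ → ℝ} (hm : Measurable φ) {B : ℝ}
    (hB : ∀ r, 0 ≤ r → |φ r| ≤ B) {δ : ℝ} (hδ : 0 < δ) (x : E) :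
    Integrable (fun η : E => φ (‖η‖ ^ 2) * (exp (-δ * ‖η‖ ^ 2) * cos (2 * π * ⟪η, x⟫))) := by
  refine ((integrable_exp_neg_mul_norm_sq (E := E) hδ).const_mul B).mono' ?_ ?_
  · exact (by fun_prop : Measurable _).aestronglyMeasurable
  · exact Eventually.of_forall fun η => abs_mul_exp_mul_cos_le (hB _ (by positivity))

theorem abs_laplace_le (ν : Measure ℝ) [IsFiniteMeasure ν] (hν : ∀ᵐ s ∂ν, 0 ≤ s) {r : ℝ}
    (hr : 0 ≤ r) : |∫ s, exp (-s * r) ∂ν| ≤ ν.real Set.univ := by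
  have := norm_integral_le_of_norm_le_const (μ := ν) (f := fun s => exp (-s * r)) (C := 1) <| by
    filter_upwards [hν] with s hs
    rw [Real.norm_eq_abs, abs_exp, exp_le_one_iff]
    nlinarith
  simpa using this

namespace IsPosDef

theorem one : IsPosDef E (fun _ => 1) where
  measurable := measurable_const
  bounded := ⟨1, fun r _ => by simp⟩
  nonneg δ hδ x := by
    simp only [one_mul]
    rw [integral_exp_neg_mul_norm_sq_mul_cos hδ]
    positivity

theorem add {φ ψ : ℝ → ℝ} (hφ : IsPosDef E φ) (hψ : IsPosDef E ψ) :
    IsPosDef E (fun r => φ r + ψ r) where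
  measurable := hφ.measurable.add hψ.measurable
  bounded := by
    obtain ⟨A, hA⟩ := hφ.bounded
    obtain ⟨B, hB⟩ := hψ.bounded
    exact ⟨A + B, fun r hr => (abs_add_le _ _).trans (add_le_add (hA r hr) (hB r hr))⟩
  nonneg δ hδ x := by
    obtain ⟨A, hA⟩ := hφ.bounded
    obtain ⟨B, hB⟩ := hψ.bounded
    simp only [add_mul]
    rw [integral_add (integrable_mul_exp_mul_cos hφ.measurable hA hδ x)
      (integrable_mul_exp_mul_cos hψ.measurable hB hδ x)]
    exact add_nonneg (hφ.nonneg δ hδ x) (hψ.nonneg δ hδ x)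

theorem const_mul {φ : ℝ → ℝ} (hφ : IsPosDef E φ) {c : ℝ} (hc : 0 ≤ c) :
    IsPosDef E (fun r => c * φ r) where
  measurable := hφ.measurable.const_mul c
  bounded := by
    obtain ⟨A, hA⟩ := hφ.bounded
    refine ⟨c * A, fun r hr => ?_⟩
    rw [abs_mul, abs_of_nonneg hc]
    exact mul_le_mul_of_nonneg_left (hA r hr) hc
  nonneg δ hδ x := by
    simp only [mul_assoc c]
    rw [integral_const_mul]
    exact mul_nonneg hc (hφ.nonneg δ hδ x)

theorem zero : IsPosDef E (fun _ => 0) := by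
  simpa using (one (E := E)).const_mul le_rfl

theorem sum {φ : ℕ → ℝ → ℝ} (h : ∀ k, IsPosDef E (φ k)) (n : ℕ) :
    IsPosDef E (fun r => ∑ k ∈ Finset.range n, φ k r) := by
  induction n with
  | zero => simpa using zero
  | succ n ih => simpa only [Finset.sum_range_succ] using ih.add (h n)

/-- The Gaussian factor makes a uniform bound on the `φ k` enough for dominated convergence; no
decay of the `φ k` is needed. -/
theorem of_tendsto {φ : ℕ → ℝ → ℝ} {ψ : ℝ → ℝ} (h : ∀ k, IsPosDef E (φ k)) {B : ℝ}
    (hB : ∀ k, ∀ r, 0 ≤ r → |φ k r| ≤ B) (hm : Measurable ψ)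
    (hlim : ∀ r, 0 ≤ r → Tendsto (fun k => φ k r) atTop (𝓝 (ψ r))) : IsPosDef E ψ where
  measurable := hm
  bounded := ⟨B, fun r hr => le_of_tendsto (hlim r hr).abs (Eventually.of_forall fun k => hB k r hr)⟩
  nonneg δ hδ x := by
    refine ge_of_tendsto (x := atTop) (tendsto_integral_of_dominated_convergence
      (F := fun k (η : E) => φ k (‖η‖ ^ 2) * (exp (-δ * ‖η‖ ^ 2) * cos (2 * π * ⟪η, x⟫)))
      (fun η => B * exp (-δ * ‖η‖ ^ 2)) ?_ ?_ ?_ ?_) ?_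
    · exact fun k => (integrable_mul_exp_mul_cos (h k).measurable (hB k) hδ x).aestronglyMeasurable
    · exact (integrable_exp_neg_mul_norm_sq hδ).const_mul B
    · exact fun k => Eventually.of_forall fun η => abs_mul_exp_mul_cos_le (hB k _ (by positivity))
    · exact Eventually.of_forall fun η => (hlim _ (by positivity)).mul_const _
    · exact Eventually.of_forall fun k => (h k).nonneg δ hδ x

theorem congr {φ ψ : ℝ → ℝ} (h : IsPosDef E φ) (hm : Measurable ψ)
    (hψ : ∀ r, 0 ≤ r → φ r = ψ r) : IsPosDef E ψ := by
  obtain ⟨B, hB⟩ := h.bounded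
  exact of_tendsto (fun _ => h) (fun _ => hB) hm fun r hr => hψ r hr ▸ tendsto_const_nhds

/-- By Fubini, each factor `e^{-s‖η‖²}` merges with the regularization, turning `δ` into `s + δ`.
This is why `IsPosDef` quantifies over every `δ > 0`. -/
theorem mul_laplace {φ : ℝ → ℝ} (hφ : IsPosDef E φ) (ν : Measure ℝ) [IsFiniteMeasure ν]
    (hν : ∀ᵐ s ∂ν, 0 ≤ s) : IsPosDef E (fun r => φ r * ∫ s, exp (-s * r) ∂ν) where
  measurable := by
    refine hφ.measurable.mul (StronglyMeasurable.measurable ?_)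
    refine StronglyMeasurable.integral_prod_right (f := fun (r s : ℝ) => exp (-s * r)) ?_
    exact Continuous.stronglyMeasurable (by fun_prop)
  bounded := by
    obtain ⟨B, hB⟩ := hφ.bounded
    have hB0 : 0 ≤ B := (abs_nonneg _).trans (hB 0 le_rfl)
    refine ⟨B * ν.real Set.univ, fun r hr => ?_⟩
    rw [abs_mul]
    exact mul_le_mul (hB r hr) (abs_laplace_le ν hν hr) (abs_nonneg _) hB0
  nonneg δ hδ x := by
    obtain ⟨B, hB⟩ := hφ.bounded
    have key : ∀ η : E, φ (‖η‖ ^ 2) * (∫ s, exp (-s * ‖η‖ ^ 2) ∂ν) *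
        (exp (-δ * ‖η‖ ^ 2) * cos (2 * π * ⟪η, x⟫)) =
        ∫ s, φ (‖η‖ ^ 2) * (exp (-(s + δ) * ‖η‖ ^ 2) * cos (2 * π * ⟪η, x⟫)) ∂ν := by
      intro η
      rw [mul_right_comm, ← integral_const_mul]
      congr 1 with s
      rw [neg_add, add_mul, exp_add]
      ring
    simp_rw [key]
    rw [integral_integral_swap]
    · refine integral_nonneg_of_ae ?_
      filter_upwards [hν] with s hs
      exact hφ.nonneg (s + δ) (by positivity) x
    · have hdom : Integrable (fun p : E × ℝ => B * exp (-δ * ‖p.1‖ ^ 2))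
          ((volume : Measure E).prod ν) :=
        (((integrable_exp_neg_mul_norm_sq (E := E) hδ).const_mul B).comp_fst ν)
      refine hdom.mono' ?_ ?_
      · have := hφ.measurable
        refine Measurable.aestronglyMeasurable ?_
        unfold Function.uncurry
        fun_prop
      · have : ∀ᵐ p ∂((volume : Measure E).prod ν), 0 ≤ p.2 :=
          Measure.quasiMeasurePreserving_snd.ae hν
        filter_upwards [this] with p hp
        refine (abs_mul_exp_mul_cos_le (hB _ (by positivity))).trans ?_
        have hB0 : 0 ≤ B := (abs_nonneg _).trans (hB 0 le_rfl)
        gcongr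
        linarith

theorem laplace_pow (ν : Measure ℝ) [IsFiniteMeasure ν] (hν : ∀ᵐ s ∂ν, 0 ≤ s) (n : ℕ) :
    IsPosDef E (fun r => (∫ s, exp (-s * r) ∂ν) ^ n) := by
  induction n with
  | zero => simpa using one
  | succ n ih => simpa only [pow_succ] using ih.mul_laplace ν hν

/-- The power series of `exp` has nonnegative coefficients, and its partial sums are bounded by
`exp` of the total mass of `ν`. -/
theorem exp_laplace (ν : Measure ℝ) [IsFiniteMeasure ν] (hν : ∀ᵐ s ∂ν, 0 ≤ s) :
    IsPosDef E (fun r => exp (∫ s, exp (-s * r) ∂ν)) := by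
  refine of_tendsto (φ := fun n r => ∑ k ∈ Finset.range n,
      ((k.factorial : ℝ)⁻¹ * (∫ s, exp (-s * r) ∂ν) ^ k)) (B := exp (ν.real Set.univ))
    (fun n => sum (fun k => (laplace_pow ν hν k).const_mul (by positivity)) n) ?_ ?_ ?_
  · intro n r hr
    refine (Finset.abs_sum_le_sum_abs _ _).trans ?_
    refine le_trans (Finset.sum_le_sum fun k _ => ?_) (Real.sum_le_exp_of_nonneg (x := ν.real Set.univ) (by positivity) n)
    rw [abs_mul, abs_pow, abs_of_nonneg (by positivity), div_eq_inv_mul]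
    gcongr
    exact abs_laplace_le ν hν hr
  · have := (laplace_pow (E := E) ν hν 1).measurable
    simp only [pow_one] at this
    exact this.exp
  · intro r _
    have := (NormedSpace.expSeries_div_hasSum_exp (𝔸 := ℝ) (∫ s, exp (-s * r) ∂ν)).tendsto_sum_nat
    rw [← Real.exp_eq_exp_ℝ] at this
    simpa only [div_eq_inv_mul] using this

end IsPosDef

end PositiveDefinite

/-! ### Subordination: fractional powers as mixtures of exponentials -/

section PowerLaplace

/-- Near zero `1 - e^{-sr} ≤ sr` leaves `s^{-β}`, integrable since `β < 1`; at infinity `s^{-1-β}`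
is integrable since `β > 0`. -/
theorem integrableOn_one_sub_exp_mul_rpow {β r : ℝ} (h0 : 0 < β) (h1 : β < 1) (hr : 0 ≤ r) :
    IntegrableOn (fun s : ℝ => (1 - exp (-s * r)) * s ^ (-1 - β)) (Set.Ioi 0) := by
  rw [← Set.Ioc_union_Ioi_eq_Ioi zero_le_one]
  refine IntegrableOn.union ?_ ?_
  · have h : IntegrableOn (fun s : ℝ => r * s ^ (-β)) (Set.Ioc 0 1) := by
      rw [← intervalIntegrable_iff_integrableOn_Ioc_of_le zero_le_one]
      exact (intervalIntegral.intervalIntegrable_rpow' (by linarith)).const_mul r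
    refine h.mono' ?_ ?_
    · exact (by fun_prop : Measurable _).aestronglyMeasurable
    · refine (ae_restrict_iff' measurableSet_Ioc).2 (Eventually.of_forall fun s hs => ?_)
      have hs0 : 0 < s := hs.1
      have he : exp (-s * r) ≤ 1 := exp_le_one_iff.2 (by nlinarith)
      have he' : 1 - exp (-s * r) ≤ s * r := by
        have := add_one_le_exp (-s * r); linarith
      rw [norm_mul, Real.norm_of_nonneg (by linarith), Real.norm_of_nonneg (by positivity)]
      calc (1 - exp (-s * r)) * s ^ (-1 - β) ≤ (s * r) * s ^ (-1 - β) := by gcongr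
        _ = r * s ^ (-β) := by
          rw [show -β = 1 + (-1 - β) by ring, rpow_add hs0, rpow_one]; ring
  · refine (integrableOn_Ioi_rpow_of_lt (a := -1 - β) (by linarith) zero_lt_one).mono' ?_ ?_
    · exact (by fun_prop : Measurable _).aestronglyMeasurable
    · refine (ae_restrict_iff' measurableSet_Ioi).2 (Eventually.of_forall fun s hs => ?_)
      have hs0 : 0 < s := zero_lt_one.trans hs
      have he : exp (-s * r) ≤ 1 := exp_le_one_iff.2 (by nlinarith)
      rw [norm_mul, Real.norm_of_nonneg (by linarith), Real.norm_of_nonneg (by positivity)]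
      refine mul_le_of_le_one_left (by positivity) ?_
      linarith [exp_pos (-s * r)]

theorem integral_one_sub_exp_mul_rpow {β r : ℝ} (h0 : 0 < β) (hr : 0 ≤ r) :
    ∫ s in Set.Ioi (0 : ℝ), (1 - exp (-s * r)) * s ^ (-1 - β) =
      r ^ β * ∫ s in Set.Ioi (0 : ℝ), (1 - exp (-s)) * s ^ (-1 - β) := by
  rcases hr.eq_or_lt with rfl | hr
  · simp [h0.ne']
  have h := integral_comp_mul_left_Ioi' (fun s => (1 - exp (-s)) * s ^ (-1 - β)) 0 hr
  rw [mul_zero] at h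
  rw [← h, smul_eq_mul, ← integral_const_mul, ← integral_const_mul]
  refine setIntegral_congr_fun measurableSet_Ioi fun s hs => ?_
  have hs : 0 < s := hs
  rw [mul_rpow hr.le hs.le, show -(r * s) = -s * r by ring]
  have : r ^ β * (r * r ^ (-1 - β)) = 1 := by
    nth_rewrite 2 [← rpow_one r]
    rw [← rpow_add hr, ← rpow_add hr]; ring_nf; exact rpow_zero r
  linear_combination (-(1 - exp (-s * r)) * s ^ (-1 - β)) * this

theorem integral_one_sub_exp_mul_rpow_pos {β : ℝ} (h0 : 0 < β) (h1 : β < 1) :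
    0 < ∫ s in Set.Ioi (0 : ℝ), (1 - exp (-s)) * s ^ (-1 - β) := by
  have hi := integrableOn_one_sub_exp_mul_rpow h0 h1 zero_le_one
  simp only [mul_one] at hi
  have hpos : ∀ s ∈ Set.Ioi (0 : ℝ), 0 < (1 - exp (-s)) * s ^ (-1 - β) := fun s hs => by
    have hs : 0 < s := hs
    have : exp (-s) < 1 := exp_lt_one_iff.2 (neg_lt_zero.2 hs)
    have := sub_pos.2 this
    positivity
  rw [setIntegral_pos_iff_support_of_nonneg_ae _ hi]
  · rw [Set.inter_eq_self_of_subset_right (show Set.Ioi (0 : ℝ) ⊆ Function.support _ from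
      fun s hs => (hpos s hs).ne')]
    simp
  · exact (ae_restrict_iff' measurableSet_Ioi).2 (Eventually.of_forall fun s hs => (hpos s hs).le)

variable {E : Type*} [NormedAddCommGroup E] [InnerProductSpace ℝ E] [FiniteDimensional ℝ E]
  [MeasurableSpace E] [BorelSpace E]

/-- Away from zero the density `c s^{-1-β}` defines a finite measure `ν`, so the integral splits and
the function equals `e^{-ν(ℝ)}` times the exponential of the Laplace transform of `ν`. -/
theorem isPosDef_exp_neg_setIntegral {β c a : ℝ} (h0 : 0 < β) (hc : 0 ≤ c) (ha : 0 < a) :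
    IsPosDef E (fun r =>
      exp (-(c * ∫ s in Set.Ioi a, (1 - exp (-s * r)) * s ^ (-1 - β)))) := by
  have hi : IntegrableOn (fun s : ℝ => c * s ^ (-1 - β)) (Set.Ioi a) :=
    (integrableOn_Ioi_rpow_of_lt (by linarith) ha).const_mul c
  have hpos : ∀ᵐ s ∂(volume.restrict (Set.Ioi a)), 0 < s :=
    (ae_restrict_iff' measurableSet_Ioi).2 (Eventually.of_forall fun s hs => ha.trans hs)
  have hdpos : ∀ᵐ s ∂(volume.restrict (Set.Ioi a)), 0 ≤ c * s ^ (-1 - β) := by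
    filter_upwards [hpos] with s hs
    positivity
  set ν : Measure ℝ := (volume.restrict (Set.Ioi a)).withDensity
    (fun s => ENNReal.ofReal (c * s ^ (-1 - β))) with hν
  have hfin : IsFiniteMeasure ν := by
    refine isFiniteMeasure_withDensity_ofReal ?_
    exact hi.hasFiniteIntegral
  have hν0 : ∀ᵐ s ∂ν, 0 ≤ s :=
    (withDensity_absolutelyContinuous _ _).ae_le (hpos.mono fun s hs => hs.le)
  have hlap : ∀ r, ∫ s, exp (-s * r) ∂ν =
      ∫ s in Set.Ioi a, (c * s ^ (-1 - β)) * exp (-s * r) := fun r => by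
    rw [hν, integral_withDensity_eq_integral_toReal_smul (by fun_prop)
      (Eventually.of_forall fun _ => ENNReal.ofReal_lt_top)]
    refine integral_congr_ae ?_
    filter_upwards [hdpos] with s hs
    rw [ENNReal.toReal_ofReal hs, smul_eq_mul]
  refine ((IsPosDef.exp_laplace (E := E) ν hν0).const_mul
    (exp_pos (-∫ s in Set.Ioi a, c * s ^ (-1 - β))).le).congr ?_ ?_
  · have : Measurable fun r => ∫ s in Set.Ioi a, (1 - exp (-s * r)) * s ^ (-1 - β) :=
      (StronglyMeasurable.integral_prod_right
        (f := fun r s : ℝ => (1 - exp (-s * r)) * s ^ (-1 - β))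
        (by unfold Function.uncurry; exact (by fun_prop : Measurable _).stronglyMeasurable)).measurable
    fun_prop
  · intro r hr
    have hi2 : IntegrableOn (fun s : ℝ => (c * s ^ (-1 - β)) * exp (-s * r)) (Set.Ioi a) := by
      refine hi.mono' (by fun_prop : Measurable _).aestronglyMeasurable ?_
      filter_upwards [hdpos, hpos] with s hs hs0
      rw [norm_mul, Real.norm_of_nonneg hs, Real.norm_of_nonneg (exp_pos _).le]
      exact mul_le_of_le_one_right hs (exp_le_one_iff.2 (by nlinarith))
    rw [← exp_add, hlap, ← integral_const_mul]
    congr 1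
    rw [neg_add_eq_sub, ← neg_sub, ← integral_sub hi hi2]
    congr 2 with s
    ring

theorem isPosDef_exp_neg_mul_rpow {β κ : ℝ} (h0 : 0 < β) (h1 : β ≤ 1) (hκ : 0 ≤ κ) :
    IsPosDef E (fun r => exp (-(κ * r ^ β))) := by
  rcases h1.eq_or_lt with rfl | h1
  -- For `β = 1` the singular integral diverges, but `e^{-κr}` is itself the Laplace transform of a
  -- point mass at `κ`.
  · have := (IsPosDef.one (E := E)).mul_laplace (Measure.dirac κ) (by simpa using hκ)
    simpa using this
  set I := ∫ s in Set.Ioi (0 : ℝ), (1 - exp (-s)) * s ^ (-1 - β) with hI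
  have hIpos : 0 < I := integral_one_sub_exp_mul_rpow_pos h0 h1
  -- Dividing by `I` normalizes the integral to `κ r^β`; the cutoffs `1/(n+1)` exhaust `(0, ∞)`.
  refine IsPosDef.of_tendsto (B := 1) (fun n : ℕ => isPosDef_exp_neg_setIntegral (c := κ / I)
    (a := 1 / ((n : ℝ) + 1)) h0 (by positivity) (by positivity)) ?_ (by fun_prop) ?_
  · intro n r hr
    rw [abs_exp, exp_le_one_iff, neg_nonpos]
    refine mul_nonneg (by positivity) (setIntegral_nonneg measurableSet_Ioi fun s hs => ?_)
    have hs : 0 < s := lt_trans (by positivity) hs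
    have : exp (-s * r) ≤ 1 := exp_le_one_iff.2 (by nlinarith)
    have := sub_nonneg.2 this
    positivity
  · intro r hr
    have hU : ⋃ n : ℕ, Set.Ioi (1 / ((n : ℝ) + 1)) = Set.Ioi 0 := by
      ext s
      simp only [Set.mem_iUnion, Set.mem_Ioi]
      exact ⟨fun ⟨n, hn⟩ => lt_trans (by positivity) hn, fun hs => exists_nat_one_div_lt hs⟩
    have hi := integrableOn_one_sub_exp_mul_rpow h0 h1 hr
    have hlim := tendsto_setIntegral_of_monotone (μ := volume)
      (s := fun n : ℕ => Set.Ioi (1 / ((n : ℝ) + 1)))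
      (f := fun s => (1 - exp (-s * r)) * s ^ (-1 - β)) (fun n => measurableSet_Ioi)
      (fun m n hmn => Set.Ioi_subset_Ioi (one_div_le_one_div_of_le (by positivity) (by simpa)))
      (by rw [hU]; exact hi)
    rw [hU, integral_one_sub_exp_mul_rpow h0 hr, ← hI] at hlim
    have := ((hlim.const_mul (κ / I)).neg).rexp
    rwa [show κ / I * (r ^ β * I) = κ * r ^ β by field_simp] at this

end PowerLaplace

/-! ### The profile: nonnegativity and mass -/

section Profile

theorem integrable_exp_neg_mul_norm_rpow (d : ℕ) {κ p : ℝ} (hκ : 0 < κ) (hp : 0 < p) :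
    Integrable (fun η : Space d => exp (-κ * ‖η‖ ^ p)) := by
  -- Polar coordinates need a nontrivial space, so dimension zero is treated apart.
  rcases Nat.eq_zero_or_pos d with rfl | hd
  · refine Integrable.of_finite
  · have : Nonempty (Fin d) := ⟨⟨0, hd⟩⟩
    have : Nontrivial (Space d) := inferInstance
    rw [integrable_fun_norm_addHaar volume (f := fun y : ℝ => exp (-κ * y ^ p))]
    have := integrableOn_rpow_mul_exp_neg_mul_rpow
      (s := ((Module.finrank ℝ (Space d) - 1 : ℕ) : ℝ)) (p := p) (b := κ)
      (by have : (0 : ℝ) ≤ ((Module.finrank ℝ (Space d) - 1 : ℕ) : ℝ) := by positivity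
          linarith) hp hκ
    simpa only [rpow_natCast, smul_eq_mul] using this

/-- The symbol `exp (-|ξ|^(2β))` at `ξ = 2π η`. -/
noncomputable def symbol (d : ℕ) (β : ℝ) (η : Space d) : ℝ :=
  exp (-‖(2 * π) • η‖ ^ (2 * β))

variable {d : ℕ} {β : ℝ}

theorem symbol_eq (η : Space d) :
    symbol d β η = exp (-(2 * π) ^ (2 * β) * ‖η‖ ^ (2 * β)) := by
  rw [symbol, norm_smul, Real.norm_of_nonneg (by positivity), mul_rpow (by positivity)
    (norm_nonneg _), neg_mul]

theorem symbol_eq_norm_sq (η : Space d) :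
    symbol d β η = exp (-((2 * π) ^ (2 * β) * (‖η‖ ^ 2) ^ β)) := by
  rw [symbol_eq, neg_mul, rpow_mul (norm_nonneg η), rpow_two]

theorem symbol_pos (η : Space d) : 0 < symbol d β η := exp_pos _

theorem symbol_le_one (η : Space d) : symbol d β η ≤ 1 := by
  rw [symbol, exp_le_one_iff, neg_nonpos]
  positivity

theorem integrable_symbol (hβ : 0 < β) : Integrable (symbol d β) := by
  have := integrable_exp_neg_mul_norm_rpow d (κ := (2 * π) ^ (2 * β)) (p := 2 * β)
    (by positivity) (by positivity)
  exact this.congr (Eventually.of_forall fun η => (symbol_eq η).symm)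

theorem profile_eq_integral (hβ : 0 < β) (x : Space d) :
    profile d β x = ∫ η, symbol d β η * cos (2 * π * ⟪η, x⟫) := by
  have hint : Integrable (fun v : Space d => Complex.exp (((2 * π * ⟪v, x⟫ : ℝ) : ℂ) * Complex.I) •
      ((symbol d β v : ℝ) : ℂ)) := by
    refine (integrable_symbol hβ).mono' ?_ ?_
    · have := (integrable_symbol (d := d) hβ).aestronglyMeasurable.aemeasurable
      exact (by fun_prop : AEMeasurable _ _).aestronglyMeasurable
    · refine Eventually.of_forall fun v => le_of_eq ?_
      rw [norm_smul, Complex.norm_exp_ofReal_mul_I, one_mul, Complex.norm_real,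
        Real.norm_of_nonneg (symbol_pos v).le]
  change (𝓕⁻ (fun η : Space d => ((symbol d β η : ℝ) : ℂ)) x).re = _
  rw [Real.fourierInv_eq', ← RCLike.re_eq_complex_re, ← integral_re hint]
  congr 1 with v
  rw [RCLike.re_eq_complex_re, smul_eq_mul, Complex.re_mul_ofReal, Complex.exp_ofReal_mul_I_re,
    mul_comm]

theorem norm_symbol_mul_cos_le (η : Space d) (θ : ℝ) :
    ‖symbol d β η * cos θ‖ ≤ symbol d β η := by
  rw [norm_mul, Real.norm_of_nonneg (symbol_pos η).le]
  exact mul_le_of_le_one_right (symbol_pos η).le (abs_cos_le_one θ)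

theorem aestronglyMeasurable_symbol_mul_cos (hβ : 0 < β) (x : Space d) :
    AEStronglyMeasurable (fun η : Space d => symbol d β η * cos (2 * π * ⟪η, x⟫)) := by
  have := (integrable_symbol (d := d) hβ).aestronglyMeasurable.aemeasurable
  exact (by fun_prop : AEMeasurable _ _).aestronglyMeasurable

theorem continuous_profile (hβ : 0 < β) : Continuous (profile d β) := by
  rw [funext (profile_eq_integral hβ)]
  refine continuous_of_dominated (bound := symbol d β) (aestronglyMeasurable_symbol_mul_cos hβ)
    (fun x => Eventually.of_forall fun η => norm_symbol_mul_cos_le η _) (integrable_symbol hβ)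
    (Eventually.of_forall fun η => by fun_prop)

/-- Each regularized integral is nonnegative, and the regularization is removed by letting `δ → 0⁺`,
with the symbol as dominating function. -/
theorem profile_nonneg (h0 : 0 < β) (h1 : β ≤ 1) (x : Space d) : 0 ≤ profile d β x := by
  have hpd := isPosDef_exp_neg_mul_rpow (E := Space d) h0 h1
    (κ := (2 * π) ^ (2 * β)) (by positivity)
  rw [profile_eq_integral h0]
  have hlim : Tendsto (fun δ : ℝ => ∫ η : Space d,
      exp (-((2 * π) ^ (2 * β) * (‖η‖ ^ 2) ^ β)) *
        (exp (-δ * ‖η‖ ^ 2) * cos (2 * π * ⟪η, x⟫))) (𝓝[>] 0)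
      (𝓝 (∫ η, symbol d β η * cos (2 * π * ⟪η, x⟫))) := by
    refine tendsto_integral_filter_of_dominated_convergence (symbol d β) ?_ ?_
      (integrable_symbol h0) ?_
    · exact Eventually.of_forall fun δ => (by fun_prop : Measurable _).aestronglyMeasurable
    · filter_upwards [self_mem_nhdsWithin] with δ hδ
      have hδ : 0 < δ := hδ
      refine Eventually.of_forall fun η => ?_
      rw [← symbol_eq_norm_sq, ← mul_assoc, mul_right_comm, norm_mul]
      refine (mul_le_of_le_one_right (norm_nonneg _) ?_).trans (norm_symbol_mul_cos_le η _)
      rw [Real.norm_of_nonneg (exp_pos _).le, exp_le_one_iff]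
      have : 0 ≤ ‖η‖ ^ 2 := by positivity
      nlinarith
    · refine Eventually.of_forall fun η => ?_
      rw [← symbol_eq_norm_sq]
      have : Tendsto (fun δ : ℝ => symbol d β η * (exp (-δ * ‖η‖ ^ 2) * cos (2 * π * ⟪η, x⟫)))
          (𝓝 0) (𝓝 (symbol d β η * (exp (-0 * ‖η‖ ^ 2) * cos (2 * π * ⟪η, x⟫)))) :=
        Continuous.tendsto (by fun_prop) 0
      simp only [neg_zero, zero_mul, exp_zero, one_mul] at this
      exact this.mono_left nhdsWithin_le_nhds
  refine ge_of_tendsto hlim ?_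
  filter_upwards [self_mem_nhdsWithin] with δ hδ
  exact hpd.nonneg δ hδ x

theorem integrable_profile_mul_exp (hβ : 0 < β) {ε : ℝ} (hε : 0 < ε) :
    Integrable (fun x : Space d => profile d β x * exp (-ε * ‖x‖ ^ 2)) := by
  refine ((integrable_exp_neg_mul_norm_sq hε).const_mul (∫ η, symbol d β η)).mono' ?_ ?_
  · have := continuous_profile (d := d) hβ
    exact (by fun_prop : Continuous _).aestronglyMeasurable
  · refine Eventually.of_forall fun x => ?_
    rw [norm_mul, Real.norm_of_nonneg (exp_pos _).le]
    gcongr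
    rw [profile_eq_integral hβ]
    exact norm_integral_le_of_norm_le (integrable_symbol hβ)
      (Eventually.of_forall fun η => norm_symbol_mul_cos_le η _)

/-- Fubini moves the Fourier transform onto the Gaussian, which becomes a probability density in
`η`; the symbol is at most one. The Gaussian weight avoids presupposing that the profile is
integrable. -/
theorem integral_profile_mul_exp_le_one (hβ : 0 < β) {ε : ℝ} (hε : 0 < ε) :
    ∫ x : Space d, profile d β x * exp (-ε * ‖x‖ ^ 2) ≤ 1 := by
  have hg (η : Space d) := integral_exp_neg_mul_norm_sq_mul_cos hε η
  have hgi : Integrable fun η : Space d =>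
      (π / ε) ^ (Module.finrank ℝ (Space d) / 2 : ℝ) * exp (-π ^ 2 * ‖η‖ ^ 2 / ε) := by
    have := (integrable_exp_neg_mul_norm_sq (E := Space d) (δ := π ^ 2 / ε)
      (by positivity)).const_mul ((π / ε) ^ (Module.finrank ℝ (Space d) / 2 : ℝ))
    convert this using 4
    ring
  have hgone : ∫ η : Space d,
      (π / ε) ^ (Module.finrank ℝ (Space d) / 2 : ℝ) * exp (-π ^ 2 * ‖η‖ ^ 2 / ε) = 1 := by
    have h := GaussianFourier.integral_rexp_neg_mul_sq_norm (V := Space d) (b := π ^ 2 / ε)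
      (by positivity)
    rw [integral_const_mul]
    have e : (fun η : Space d => exp (-π ^ 2 * ‖η‖ ^ 2 / ε)) =
        fun η => exp (-(π ^ 2 / ε) * ‖η‖ ^ 2) := by
      ext η; ring_nf
    rw [e, h, ← mul_rpow (by positivity) (by positivity)]
    have : π / ε * (π / (π ^ 2 / ε)) = 1 := by field_simp
    rw [this, one_rpow]
  calc ∫ x : Space d, profile d β x * exp (-ε * ‖x‖ ^ 2)
      = ∫ x : Space d, ∫ η : Space d, symbol d β η * (exp (-ε * ‖x‖ ^ 2) *
          cos (2 * π * ⟪x, η⟫)) := by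
        congr 1 with x
        rw [profile_eq_integral hβ, ← integral_mul_const]
        congr 1 with η
        rw [real_inner_comm]
        ring
    _ = ∫ η : Space d, ∫ x : Space d, symbol d β η * (exp (-ε * ‖x‖ ^ 2) *
          cos (2 * π * ⟪x, η⟫)) := by
        refine integral_integral_swap ?_
        refine ((integrable_exp_neg_mul_norm_sq (E := Space d) hε).mul_prod
          (integrable_symbol (d := d) hβ)).mono' ?_ ?_
        · have : AEMeasurable (fun p : Space d × Space d => symbol d β p.2)
              (volume.prod volume) :=
            (integrable_symbol (d := d) hβ).aestronglyMeasurable.aemeasurable.comp_snd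
          unfold Function.uncurry
          exact (by fun_prop : AEMeasurable _ _).aestronglyMeasurable
        · refine Eventually.of_forall fun p => ?_
          rw [mul_comm (exp (-ε * ‖p.1‖ ^ 2)) (symbol d β p.2)]
          exact abs_mul_exp_mul_cos_le (abs_of_pos (symbol_pos _)).le
    _ = ∫ η : Space d, symbol d β η *
          ((π / ε) ^ (Module.finrank ℝ (Space d) / 2 : ℝ) * exp (-π ^ 2 * ‖η‖ ^ 2 / ε)) := by
        congr 1 with η
        rw [integral_const_mul, hg]
    _ ≤ ∫ η : Space d,
          (π / ε) ^ (Module.finrank ℝ (Space d) / 2 : ℝ) * exp (-π ^ 2 * ‖η‖ ^ 2 / ε) := by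
        refine integral_mono_of_nonneg (Eventually.of_forall fun η => ?_) hgi
          (Eventually.of_forall fun η => ?_)
        · have := symbol_pos (β := β) η
          positivity
        · exact mul_le_of_le_one_left (by positivity) (symbol_le_one η)
    _ = 1 := hgone

/-- Nonnegativity turns the bound on signed weighted integrals into an `L¹` bound, and Fatou's lemma
removes the weight. -/
theorem lintegral_enorm_profile_le_one (h0 : 0 < β) (h1 : β ≤ 1) :
    ∫⁻ x : Space d, ‖profile d β x‖ₑ ≤ 1 := by
  have hc := continuous_profile (d := d) h0
  let G : ℕ → Space d → ℝ := fun n x => profile d β x * exp (-(1 / ((n : ℝ) + 1)) * ‖x‖ ^ 2)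
  have hG (n : ℕ) : Continuous (G n) := by fun_prop
  have hlim (x : Space d) : Tendsto (fun n => ‖G n x‖ₑ) atTop (𝓝 ‖profile d β x‖ₑ) := by
    refine Tendsto.enorm ?_
    have := (((tendsto_one_div_add_atTop_nhds_zero_nat (𝕜 := ℝ)).neg.mul_const
      (‖x‖ ^ 2)).rexp).const_mul (profile d β x)
    simpa only [neg_zero, zero_mul, exp_zero, mul_one] using this
  have hle (n : ℕ) : ∫⁻ x, ‖G n x‖ₑ ≤ 1 := by
    have hi := integrable_profile_mul_exp (d := d) h0 (ε := 1 / ((n : ℝ) + 1)) (by positivity)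
    rw [← ofReal_integral_norm_eq_lintegral_enorm hi]
    refine ENNReal.ofReal_le_one.2 ?_
    refine le_trans (le_of_eq ?_) (integral_profile_mul_exp_le_one (d := d) h0
      (ε := 1 / ((n : ℝ) + 1)) (by positivity))
    refine integral_congr_ae (Eventually.of_forall fun x => ?_)
    exact Real.norm_of_nonneg (mul_nonneg (profile_nonneg h0 h1 x) (exp_pos _).le)
  calc ∫⁻ x, ‖profile d β x‖ₑ = ∫⁻ x, liminf (fun n => ‖G n x‖ₑ) atTop := by
        congr 1 with x
        exact (hlim x).liminf_eq.symm
    _ ≤ liminf (fun n => ∫⁻ x, ‖G n x‖ₑ) atTop :=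
        lintegral_liminf_le fun n => (hG n).enorm.measurable
    _ ≤ 1 := (liminf_le_liminf (Eventually.of_forall hle)).trans (by simp)

theorem integrable_profile (h0 : 0 < β) (h1 : β ≤ 1) : Integrable (profile d β) :=
  ⟨(continuous_profile h0).aestronglyMeasurable,
    (lintegral_enorm_profile_le_one h0 h1).trans_lt ENNReal.one_lt_top⟩

theorem integral_norm_profile_le_one (h0 : 0 < β) (h1 : β ≤ 1) :
    ∫ x : Space d, ‖profile d β x‖ ≤ 1 := by
  rw [integral_norm_eq_lintegral_enorm (integrable_profile h0 h1).aestronglyMeasurable]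
  exact ENNReal.toReal_le_of_le_ofReal zero_le_one
    (by simpa using lintegral_enorm_profile_le_one h0 h1)

end Profile

/-! ### Bounds on the limsup of the norm at infinity -/

section LimsupNorm

variable {d : ℕ} {Z : Type*} [NormedAddCommGroup Z]

/-- Needed for dominated convergence along `|x| → ∞`. -/
theorem isCountablyGenerated_cobounded (d : ℕ) :
    (Bornology.cobounded (Space d)).IsCountablyGenerated := by
  rw [← comap_norm_atTop]
  infer_instance

/-- `limsup ‖f x‖ ≤ B` as `|x| → ∞`. -/
def LimsupNormLE (f : Space d → Z) (B : ℝ) : Prop :=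
  Tendsto (fun x => max (‖f x‖ - B) 0) (Bornology.cobounded (Space d)) (𝓝 0)

theorem limsupNormLE_zero_iff {f : Space d → Z} :
    LimsupNormLE f 0 ↔ Tendsto f (Bornology.cobounded (Space d)) (𝓝 0) := by
  unfold LimsupNormLE
  simp only [sub_zero, max_eq_left (norm_nonneg _)]
  exact tendsto_zero_iff_norm_tendsto_zero.symm

theorem LimsupNormLE.mono {f : Space d → Z} {A B : ℝ} (h : LimsupNormLE f A) (hAB : A ≤ B) :
    LimsupNormLE f B :=
  squeeze_zero (fun _ => le_max_right _ _)
    (fun _ => max_le_max_right _ (sub_le_sub_left hAB _)) h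

theorem LimsupNormLE.of_forall {f : Space d → Z} {B : ℝ} (h : ∀ x, ‖f x‖ ≤ B) :
    LimsupNormLE f B := by
  unfold LimsupNormLE
  simp only [fun x => max_eq_right (sub_nonpos.2 (h x))]
  exact tendsto_const_nhds

theorem LimsupNormLE.add {f g : Space d → Z} {A B : ℝ} (hf : LimsupNormLE f A)
    (hg : LimsupNormLE g B) : LimsupNormLE (fun x => f x + g x) (A + B) := by
  refine squeeze_zero (fun _ => le_max_right _ _) (fun x => ?_) (by simpa using Tendsto.add hf hg)
  refine max_le ?_ (by positivity)
  linarith [norm_add_le (f x) (g x), le_max_left (‖f x‖ - A) 0, le_max_left (‖g x‖ - B) 0]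

theorem LimsupNormLE.of_norm_le_mul {f g : Space d → Z} {B L : ℝ} (hL : 0 ≤ L)
    (hg : LimsupNormLE g B) (h : ∀ x, ‖f x‖ ≤ L * ‖g x‖) : LimsupNormLE f (L * B) := by
  refine squeeze_zero (fun _ => le_max_right _ _) (fun x => ?_)
    (by simpa using Tendsto.const_mul L hg)
  refine max_le ?_ (by positivity)
  nlinarith [h x, le_max_left (‖g x‖ - B) 0]

theorem limsupNormLE_zero_of_tendsto {f : Space d → Z} {B : ℕ → ℝ}
    (hB : Tendsto B atTop (𝓝 0)) (h : ∀ n, LimsupNormLE f (B n)) : LimsupNormLE f 0 := by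
  refine Metric.tendsto_nhds.2 fun ε hε => ?_
  obtain ⟨n, hn⟩ := (hB.eventually_lt_const (half_pos hε)).exists
  filter_upwards [(h n).eventually_lt_const (half_pos hε)] with x hx
  rw [Real.dist_eq, sub_zero, sub_zero, abs_of_nonneg (le_max_right _ _)]
  refine max_lt ?_ hε
  linarith [le_max_left (‖f x‖ - B n) 0]

end LimsupNorm

/-! ### The semigroup: contraction and behaviour at infinity -/

section Semigroup

variable {d : ℕ} {σ β t : ℝ}

theorem integrable_green (h0 : 0 < β) (h1 : β ≤ 1) (ht : 0 < σ * t) :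
    Integrable (green d σ β t) :=
  ((integrable_profile h0 h1).comp_smul (rpow_pos_of_pos ht _).ne').const_mul _

/-- The prefactor of Green's function is exactly the Jacobian of the dilation, so the bound for the
profile carries over. -/
theorem integral_norm_green_le_one (h0 : 0 < β) (h1 : β ≤ 1) (ht : 0 < σ * t) :
    ∫ x, ‖green d σ β t x‖ ≤ 1 := by
  have ha : 0 < (σ * t) ^ (-1 / (2 * β)) := rpow_pos_of_pos ht _
  have hb : 0 < (σ * t) ^ (-(d : ℝ) / (2 * β)) := rpow_pos_of_pos ht _
  simp only [green, norm_mul, Real.norm_of_nonneg hb.le]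
  rw [integral_const_mul,
    Measure.integral_comp_smul volume (fun x : Space d => ‖profile d β x‖), smul_eq_mul,
    ← mul_assoc, finrank_euclideanSpace_fin, abs_of_pos (by positivity), ← rpow_natCast,
    ← rpow_mul ht.le, show -1 / (2 * β) * d = -(d : ℝ) / (2 * β) by ring,
    mul_inv_cancel₀ hb.ne', one_mul]
  exact integral_norm_profile_le_one h0 h1

theorem continuousOn_green (h0 : 0 < β) :
    ContinuousOn (fun p : ℝ × Space d => green d σ β p.1 p.2) {p | 0 < σ * p.1} := by
  have hc : ContinuousOn (fun p : ℝ × Space d => σ * p.1) {p | 0 < σ * p.1} := by fun_prop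
  refine (hc.rpow_const fun p hp => Or.inl (ne_of_gt hp)).mul
    ((continuous_profile h0).comp_continuousOn ?_)
  exact (hc.rpow_const fun p hp => Or.inl (ne_of_gt hp)).smul continuousOn_snd

variable {Z : Type*} [NormedAddCommGroup Z] [NormedSpace ℝ Z]

theorem integrable_green_smul (h0 : 0 < β) (h1 : β ≤ 1) (ht : 0 < σ * t) {f : Space d → Z}
    (hf : Continuous f) {K : ℝ} (hK : ∀ x, ‖f x‖ ≤ K) (x : Space d) :
    Integrable (fun y => green d σ β t y • f (x - y)) := by
  have hg := integrable_green (d := d) h0 h1 ht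
  refine (hg.norm.mul_const K).mono' (hg.aestronglyMeasurable.smul
    (by fun_prop : Continuous fun y => f (x - y)).aestronglyMeasurable) ?_
  refine Eventually.of_forall fun y => ?_
  rw [norm_smul]
  exact mul_le_mul_of_nonneg_left (hK _) (norm_nonneg _)

theorem semigroup_sub (h0 : 0 < β) (h1 : β ≤ 1) (ht : 0 ≤ σ * t) {f g : Space d → Z}
    (hf : Continuous f) (hg : Continuous g) {K : ℝ} (hfK : ∀ x, ‖f x‖ ≤ K)
    (hgK : ∀ x, ‖g x‖ ≤ K) (x : Space d) :
    semigroup σ β t (fun y => f y - g y) x = semigroup σ β t f x - semigroup σ β t g x := by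
  unfold semigroup
  split_ifs with h
  · rfl
  have ht' : 0 < σ * t := lt_of_le_of_ne ht (Ne.symm h)
  rw [← integral_sub (integrable_green_smul h0 h1 ht' hf hfK x)
    (integrable_green_smul h0 h1 ht' hg hgK x)]
  simp only [smul_sub]

theorem norm_semigroup_le (h0 : 0 < β) (h1 : β ≤ 1) (ht : 0 ≤ σ * t) {f : Space d → Z}
    {K : ℝ} (hK : ∀ x, ‖f x‖ ≤ K) (x : Space d) : ‖semigroup σ β t f x‖ ≤ K := by
  unfold semigroup
  split_ifs with h
  · exact hK x
  have ht' : 0 < σ * t := lt_of_le_of_ne ht (Ne.symm h)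
  have hK0 : 0 ≤ K := (norm_nonneg _).trans (hK x)
  refine (norm_integral_le_of_norm_le ((integrable_green (d := d) h0 h1 ht').norm.mul_const K)
    (Eventually.of_forall fun y => ?_)).trans ?_
  · rw [norm_smul]
    exact mul_le_mul_of_nonneg_left (hK _) (norm_nonneg _)
  · rw [integral_mul_const]
    exact mul_le_of_le_one_left hK0 (integral_norm_green_le_one h0 h1 ht')

/-- Dominated convergence applies to the excess `max (‖h s x‖ - b s) 0`, which tends to zero for
each `s`, whereas `h s x` itself need not converge. -/
theorem LimsupNormLE.intervalIntegral {h : ℝ → Space d → Z} {b : ℝ → ℝ} {K : ℝ} (ht : 0 ≤ t)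
    (hm : ∀ x, AEStronglyMeasurable (fun s => h s x) (volume.restrict (Set.Ioc 0 t)))
    (hK : ∀ s ∈ Set.Ioc 0 t, ∀ x, ‖h s x‖ ≤ K) (hb : Continuous b) (hb0 : ∀ s, 0 ≤ b s)
    (hlim : ∀ s ∈ Set.Ioc 0 t, LimsupNormLE (h s) (b s)) :
    LimsupNormLE (fun x => ∫ s in (0 : ℝ)..t, h s x) (∫ s in (0 : ℝ)..t, b s) := by
  simp only [intervalIntegral.integral_of_le ht]
  have hbi : IntegrableOn b (Set.Ioc 0 t) := hb.integrableOn_Ioc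
  have hKi : IntegrableOn (fun _ : ℝ => |K|) (Set.Ioc 0 t) := integrableOn_const (by simp)
  have hmeas (x : Space d) : AEStronglyMeasurable (fun s => max (‖h s x‖ - b s) 0)
      (volume.restrict (Set.Ioc 0 t)) :=
    (((hm x).norm.sub hb.aestronglyMeasurable).sup aestronglyMeasurable_const)
  have hbound (x : Space d) : ∀ᵐ s ∂(volume.restrict (Set.Ioc 0 t)),
      ‖max (‖h s x‖ - b s) 0‖ ≤ |K| := by
    refine (ae_restrict_iff' measurableSet_Ioc).2 (Eventually.of_forall fun s hs => ?_)
    rw [Real.norm_of_nonneg (le_max_right _ _)]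
    exact max_le (by linarith [hK s hs x, hb0 s, le_abs_self K]) (abs_nonneg K)
  have := isCountablyGenerated_cobounded d
  have hlim0 : Tendsto (fun x => ∫ s in Set.Ioc 0 t, max (‖h s x‖ - b s) 0)
      (Bornology.cobounded (Space d)) (𝓝 (∫ _ in Set.Ioc 0 t, (0 : ℝ))) := by
    refine tendsto_integral_filter_of_dominated_convergence (l := Bornology.cobounded (Space d))
      (fun _ => |K|) (Eventually.of_forall hmeas) (Eventually.of_forall hbound) hKi ?_
    exact (ae_restrict_iff' measurableSet_Ioc).2 (Eventually.of_forall hlim)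
  rw [integral_zero] at hlim0
  refine squeeze_zero (fun _ => le_max_right _ _) (fun x => ?_) hlim0
  refine max_le ?_ (integral_nonneg fun s => le_max_right _ _)
  have hi : IntegrableOn (fun s => max (‖h s x‖ - b s) 0) (Set.Ioc 0 t) :=
    hKi.mono' (hmeas x) (hbound x)
  rw [sub_le_iff_le_add', ← integral_add hbi hi]
  refine norm_integral_le_of_norm_le (hbi.add hi) (Eventually.of_forall fun s => ?_)
  linarith [le_max_left (‖h s x‖ - b s) 0]

/-- For fixed `y` the excess of `‖f (x - y)‖` over `B` vanishes as `|x| → ∞`, so its convolution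
with `|G|` does too; the remaining part is at most `B` times the `L¹` norm of `G`. -/
theorem LimsupNormLE.semigroup (h0 : 0 < β) (h1 : β ≤ 1) (ht : 0 ≤ σ * t) {f : Space d → Z}
    (hf : Continuous f) {K : ℝ} (hK : ∀ x, ‖f x‖ ≤ K) {B : ℝ} (hB : 0 ≤ B)
    (h : LimsupNormLE f B) : LimsupNormLE (semigroup σ β t f) B := by
  unfold FracRD.semigroup
  split_ifs with h'
  · exact h
  have ht' : 0 < σ * t := lt_of_le_of_ne ht (Ne.symm h')
  have hK0 : 0 ≤ K := (norm_nonneg _).trans (hK 0)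
  have hg := integrable_green (d := d) h0 h1 ht'
  have hmax (z : Space d) : max (‖f z‖ - B) 0 ≤ K :=
    max_le (by linarith [hK z]) hK0
  have hmeas (x : Space d) : AEStronglyMeasurable
      (fun y => ‖green d σ β t y‖ * max (‖f (x - y)‖ - B) 0) :=
    hg.aestronglyMeasurable.norm.mul (by fun_prop : Continuous fun y =>
      max (‖f (x - y)‖ - B) 0).aestronglyMeasurable
  have hbound (x y : Space d) : ‖‖green d σ β t y‖ * max (‖f (x - y)‖ - B) 0‖ ≤
      ‖green d σ β t y‖ * K := by
    rw [Real.norm_of_nonneg (by positivity)]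
    exact mul_le_mul_of_nonneg_left (hmax _) (norm_nonneg _)
  have : (Bornology.cobounded (Space d)).IsCountablyGenerated := isCountablyGenerated_cobounded d
  have hlim : Tendsto (fun x => ∫ y, ‖green d σ β t y‖ * max (‖f (x - y)‖ - B) 0)
      (Bornology.cobounded (Space d)) (𝓝 (∫ _ : Space d, (0 : ℝ))) := by
    refine tendsto_integral_filter_of_dominated_convergence (l := Bornology.cobounded (Space d))
      (fun y => ‖green d σ β t y‖ * K) (Eventually.of_forall hmeas) (Eventually.of_forall fun x =>
      Eventually.of_forall (hbound x)) (hg.norm.mul_const K) (Eventually.of_forall fun y => ?_)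
    simpa using (h.comp (tendsto_sub_const_cobounded y)).const_mul ‖green d σ β t y‖
  rw [integral_zero] at hlim
  refine squeeze_zero (fun x => le_max_right _ _) (fun x => ?_) hlim
  have hi : Integrable (fun y => ‖green d σ β t y‖ * max (‖f (x - y)‖ - B) 0) :=
    (hg.norm.mul_const K).mono' (hmeas x) (Eventually.of_forall (hbound x))
  refine max_le ?_ (integral_nonneg fun y => by positivity)
  have h2 : ‖∫ y, green d σ β t y • f (x - y)‖ ≤
      ∫ y, (‖green d σ β t y‖ * B + ‖green d σ β t y‖ * max (‖f (x - y)‖ - B) 0) := by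
    refine norm_integral_le_of_norm_le ((hg.norm.mul_const B).add hi)
      (Eventually.of_forall fun y => ?_)
    rw [norm_smul, ← mul_add]
    refine mul_le_mul_of_nonneg_left ?_ (norm_nonneg _)
    linarith [le_max_left (‖f (x - y)‖ - B) 0]
  rw [integral_add (hg.norm.mul_const B) hi, integral_mul_const] at h2
  have := mul_le_of_le_one_left hB (integral_norm_green_le_one (d := d) h0 h1 ht')
  linarith

theorem aestronglyMeasurable_semigroup (h0 : 0 < β) (hσ : 0 ≤ σ) {g : ℝ → Space d → Z}
    (hg : ContinuousOn (fun p : ℝ × Space d => g p.1 p.2) (Set.Icc 0 t ×ˢ Set.univ))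
    (x : Space d) :
    AEStronglyMeasurable (fun s => semigroup σ β (t - s) (g s) x)
      (volume.restrict (Set.Ioc 0 t)) := by
  -- The endpoint `s = t` is discarded because Green's function is singular at elapsed time zero.
  rw [← Measure.restrict_congr_set (Ioo_ae_eq_Ioc (μ := volume) (a := 0) (b := t))]
  rcases hσ.eq_or_lt with rfl | hσ
  · simp only [semigroup, zero_mul, if_true]
    refine ContinuousOn.aestronglyMeasurable ?_ measurableSet_Ioo
    refine hg.comp (f := fun s => (s, x)) (by fun_prop) fun s hs => ?_
    exact ⟨Set.Ioo_subset_Icc_self hs, trivial⟩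
  have hpos : ∀ s ∈ Set.Ioo 0 t, 0 < σ * (t - s) := fun s hs => mul_pos hσ (sub_pos.2 hs.2)
  have hc : ContinuousOn (fun p : ℝ × Space d => green d σ β (t - p.1) p.2 • g p.1 (x - p.2))
      (Set.Ioo 0 t ×ˢ Set.univ) := by
    refine ContinuousOn.smul ?_ ?_
    · exact (continuousOn_green h0).comp
        (f := fun p : ℝ × Space d => ((t - p.1, p.2) : ℝ × Space d)) (by fun_prop)
        fun p hp => hpos p.1 hp.1
    · exact hg.comp (f := fun p : ℝ × Space d => ((p.1, x - p.2) : ℝ × Space d)) (by fun_prop)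
        fun p hp => ⟨Set.Ioo_subset_Icc_self hp.1, trivial⟩
  have hm := hc.aestronglyMeasurable (μ := volume.prod volume)
    (measurableSet_Ioo.prod MeasurableSet.univ)
  rw [← Measure.prod_restrict, Measure.restrict_univ] at hm
  refine hm.integral_prod_right'.congr ?_
  refine (ae_restrict_iff' measurableSet_Ioo).2 (Eventually.of_forall fun s hs => ?_)
  simp only [semigroup, if_neg (hpos s hs).ne']

end Semigroup

theorem continuous_slice {d : ℕ} {Z : Type*} [NormedAddCommGroup Z] {T : ℝ}
    {g : ℝ → Space d → Z}
    (hg : ContinuousOn (fun p : ℝ × Space d => g p.1 p.2) (Set.Icc 0 T ×ˢ Set.univ))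
    {s : ℝ} (hs : s ∈ Set.Icc 0 T) : Continuous (g s) :=
  continuousOn_univ.1 (hg.comp (f := fun y : Space d => (s, y)) (by fun_prop)
    fun _ _ => ⟨hs, trivial⟩)

/-! ### Comparison of two mild solutions -/

section MildSolution

variable {d : ℕ} {Z : Type*} [NormedAddCommGroup Z] [NormedSpace ℝ Z]
  {σ β T : ℝ} {F : ℝ → Z → Z}

theorem continuousOn_superposition
    (hF : ContinuousOn (fun p : ℝ × Z => F p.1 p.2) (Set.Ici 0 ×ˢ Set.univ))
    {u : ℝ → Cu d Z} (hu : ContinuousOn u (Set.Icc 0 T)) :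
    ContinuousOn (fun p : ℝ × Space d => F p.1 ((u p.1).1 p.2)) (Set.Icc 0 T ×ˢ Set.univ) := by
  refine hF.comp (f := fun p : ℝ × Space d => (p.1, (u p.1).1 p.2)) ?_
    fun p hp => ⟨hp.1.1, trivial⟩
  refine continuousOn_fst.prodMk ?_
  have h1 : ContinuousOn (fun p : ℝ × Space d => ((u p.1).1, p.2)) (Set.Icc 0 T ×ˢ Set.univ) :=
    (continuous_subtype_val.comp_continuousOn
      (hu.comp continuousOn_fst fun p hp => hp.1)).prodMk continuousOn_snd
  exact (continuous_eval (F := Space d →ᵇ Z)).comp_continuousOn h1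

theorem intervalIntegrable_semigroup (hσ : 0 ≤ σ) (h0 : 0 < β) (h1 : β ≤ 1) (hT : 0 ≤ T)
    {g : ℝ → Space d → Z} {K : ℝ}
    (hg : ContinuousOn (fun p : ℝ × Space d => g p.1 p.2) (Set.Icc 0 T ×ˢ Set.univ))
    (hK : ∀ s ∈ Set.Icc 0 T, ∀ x, ‖g s x‖ ≤ K) (x : Space d) :
    IntervalIntegrable (fun s => semigroup σ β (T - s) (g s) x) volume 0 T := by
  rw [intervalIntegrable_iff_integrableOn_Ioc_of_le hT]
  have hc : IntegrableOn (fun _ : ℝ => K) (Set.Ioc 0 T) := integrableOn_const (by simp)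
  refine hc.mono' (aestronglyMeasurable_semigroup h0 hσ hg x) ?_
  refine (ae_restrict_iff' measurableSet_Ioc).2 (Eventually.of_forall fun s hs => ?_)
  exact norm_semigroup_le h0 h1 (mul_nonneg hσ (sub_nonneg.2 hs.2))
    (hK s (Set.Ioc_subset_Icc_self hs)) x

theorem limsupNormLE_duhamel_sub (hσ : 0 ≤ σ) (h0 : 0 < β) (h1 : β ≤ 1) (hT : 0 ≤ T)
    {f g : ℝ → Space d → Z} {K : ℝ}
    (hf : ContinuousOn (fun p : ℝ × Space d => f p.1 p.2) (Set.Icc 0 T ×ˢ Set.univ))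
    (hg : ContinuousOn (fun p : ℝ × Space d => g p.1 p.2) (Set.Icc 0 T ×ˢ Set.univ))
    (hfK : ∀ s ∈ Set.Icc 0 T, ∀ x, ‖f s x‖ ≤ K) (hgK : ∀ s ∈ Set.Icc 0 T, ∀ x, ‖g s x‖ ≤ K)
    {b : ℝ → ℝ} (hb : Continuous b) (hb0 : ∀ s, 0 ≤ b s)
    (hlim : ∀ s ∈ Set.Icc 0 T, LimsupNormLE (fun x => f s x - g s x) (b s)) :
    LimsupNormLE (fun x => (∫ s in (0 : ℝ)..T, semigroup σ β (T - s) (f s) x) -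
      ∫ s in (0 : ℝ)..T, semigroup σ β (T - s) (g s) x) (∫ s in (0 : ℝ)..T, b s) := by
  have hst : ∀ s ∈ Set.Ioc 0 T, 0 ≤ σ * (T - s) := fun s hs =>
    mul_nonneg hσ (sub_nonneg.2 hs.2)
  have hIcc : ∀ s ∈ Set.Ioc 0 T, s ∈ Set.Icc 0 T := fun s hs => Set.Ioc_subset_Icc_self hs
  have hfgK : ∀ s ∈ Set.Icc 0 T, ∀ y, ‖f s y - g s y‖ ≤ K + K := fun s hs y =>
    (norm_sub_le _ _).trans (add_le_add (hfK s hs y) (hgK s hs y))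
  have heq (x : Space d) : (∫ s in (0 : ℝ)..T, semigroup σ β (T - s) (f s) x) -
      (∫ s in (0 : ℝ)..T, semigroup σ β (T - s) (g s) x) =
      ∫ s in (0 : ℝ)..T, semigroup σ β (T - s) (fun y => f s y - g s y) x := by
    rw [← intervalIntegral.integral_sub (intervalIntegrable_semigroup hσ h0 h1 hT hf hfK x)
      (intervalIntegrable_semigroup hσ h0 h1 hT hg hgK x)]
    refine intervalIntegral.integral_congr_ae (Eventually.of_forall fun s hs => ?_)
    rw [Set.uIoc_of_le hT] at hs
    exact (semigroup_sub h0 h1 (hst s hs) (continuous_slice hf (hIcc s hs))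
      (continuous_slice hg (hIcc s hs)) (hfK s (hIcc s hs)) (hgK s (hIcc s hs)) x).symm
  simp only [heq]
  refine LimsupNormLE.intervalIntegral
    (h := fun s => semigroup σ β (T - s) (fun y => f s y - g s y)) (K := K + K) hT
    (fun x => aestronglyMeasurable_semigroup (g := fun s y => f s y - g s y) h0 hσ
      (hf.sub hg) x)
    (fun s hs x => norm_semigroup_le h0 h1 (hst s hs) (hfgK s (hIcc s hs)) x) hb hb0
    (fun s hs => ?_)
  exact LimsupNormLE.semigroup h0 h1 (hst s hs) ((continuous_slice hf (hIcc s hs)).sub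
    (continuous_slice hg (hIcc s hs))) (hfgK s (hIcc s hs)) (hb0 s) (hlim s (hIcc s hs))

theorem IsMildSolutionOn.mono {u₀ : Cu d Z} {I J : Set ℝ} {u : ℝ → Cu d Z}
    (h : IsMildSolutionOn σ β F u₀ J u) (hIJ : I ⊆ J) : IsMildSolutionOn σ β F u₀ I u :=
  ⟨h.1.mono hIJ, fun t ht => h.2 t (hIJ ht)⟩

/-- The exponent `2L` is twice the Lipschitz constant, so integrating `L M e^{2Ls}` yields the
factor `1/2`, on an interval of any length. -/
theorem limsupNormLE_sub_of_mild (hσ : 0 ≤ σ) (h0 : 0 < β) (h1 : β ≤ 1)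
    (hF : ContinuousOn (fun p : ℝ × Z => F p.1 p.2) (Set.Ici 0 ×ˢ Set.univ))
    {u₀ v₀ : Cu d Z} (hw₀ : VanishesAtInfinity (u₀ - v₀))
    {u v : ℝ → Cu d Z} (hT : 0 ≤ T) (hu : IsMildSolutionOn σ β F u₀ (Set.Icc 0 T) u)
    (hv : IsMildSolutionOn σ β F v₀ (Set.Icc 0 T) v) {K L M : ℝ} (hL : 0 ≤ L) (hM : 0 ≤ M)
    (hKu : ∀ s ∈ Set.Icc 0 T, ∀ x, ‖F s ((u s).1 x)‖ ≤ K)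
    (hKv : ∀ s ∈ Set.Icc 0 T, ∀ x, ‖F s ((v s).1 x)‖ ≤ K)
    (hLip : ∀ s ∈ Set.Icc 0 T, ∀ x,
      ‖F s ((u s).1 x) - F s ((v s).1 x)‖ ≤ L * ‖(u s).1 x - (v s).1 x‖)
    (hP : ∀ s ∈ Set.Icc 0 T,
      LimsupNormLE (fun x => (u s).1 x - (v s).1 x) (M * exp (2 * L * s))) :
    LimsupNormLE (fun x => (u T).1 x - (v T).1 x) (M / 2 * exp (2 * L * T)) := by
  have hI := limsupNormLE_duhamel_sub (K := K) hσ h0 h1 hT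
    (f := fun s x => F s ((u s).1 x)) (g := fun s x => F s ((v s).1 x))
    (continuousOn_superposition hF hu.1) (continuousOn_superposition hF hv.1) hKu hKv
    (b := fun s => L * (M * exp (2 * L * s))) (by fun_prop) (fun s => by positivity)
    fun s hs => (hP s hs).of_norm_le_mul hL (hLip s hs)
  have hexp : ∫ s in (0 : ℝ)..T, L * (M * exp (2 * L * s)) =
      M / 2 * exp (2 * L * T) - M / 2 * exp (2 * L * 0) := by
    refine intervalIntegral.integral_eq_sub_of_hasDerivAt (f := fun s => M / 2 * exp (2 * L * s))
      (fun s _ => ?_) ((by fun_prop : Continuous _).intervalIntegrable _ _)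
    have := (((hasDerivAt_id s).const_mul (2 * L)).exp).const_mul (M / 2)
    refine this.congr_deriv ?_
    simp only [id]
    ring
  have hS : LimsupNormLE (semigroup σ β T (fun y => u₀.1 y - v₀.1 y)) 0 :=
    LimsupNormLE.semigroup h0 h1 (mul_nonneg hσ hT) (u₀.1.continuous.sub v₀.1.continuous)
      (fun y => (u₀ - v₀).1.norm_coe_le_norm y) le_rfl (limsupNormLE_zero_iff.2 hw₀)
  have hTT : T ∈ Set.Icc 0 T := ⟨hT, le_rfl⟩
  have heq : (fun x => (u T).1 x - (v T).1 x) = fun x =>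
      semigroup σ β T (fun y => u₀.1 y - v₀.1 y) x +
        ((∫ s in (0 : ℝ)..T, semigroup σ β (T - s) (fun y => F s ((u s).1 y)) x) -
          ∫ s in (0 : ℝ)..T, semigroup σ β (T - s) (fun y => F s ((v s).1 y)) x) := by
    ext x
    rw [hu.2 T hTT x, hv.2 T hTT x, semigroup_sub h0 h1 (mul_nonneg hσ hT)
      u₀.1.continuous v₀.1.continuous
      (fun y => (u₀.1.norm_coe_le_norm y).trans (le_max_left _ ‖v₀.1‖))
      (fun y => (v₀.1.norm_coe_le_norm y).trans (le_max_right ‖u₀.1‖ _))]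
    abel
  rw [heq]
  refine (hS.add hI).mono ?_
  rw [hexp]
  have : 0 ≤ M / 2 * exp (2 * L * 0) := by positivity
  linarith

theorem exists_norm_apply_le {u : ℝ → Cu d Z} (hu : ContinuousOn u (Set.Icc 0 T)) :
    ∃ R, ∀ s ∈ Set.Icc 0 T, ∀ x, ‖(u s).1 x‖ ≤ R := by
  obtain ⟨R, hR⟩ := isCompact_Icc.exists_bound_of_continuousOn hu
  exact ⟨R, fun s hs x => ((u s).1.norm_coe_le_norm x).trans (hR s hs)⟩

theorem vanishesAtInfinity_sub_of_mild (hσ : 0 ≤ σ) (h0 : 0 < β) (h1 : β ≤ 1)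
    (hF : ContinuousOn (fun p : ℝ × Z => F p.1 p.2) (Set.Ici 0 ×ˢ Set.univ))
    (hFLip : LocallyLipschitzSnd F) {u₀ v₀ : Cu d Z} (hw₀ : VanishesAtInfinity (u₀ - v₀))
    {u v : ℝ → Cu d Z} (hT : 0 ≤ T) (hu : IsMildSolutionOn σ β F u₀ (Set.Icc 0 T) u)
    (hv : IsMildSolutionOn σ β F v₀ (Set.Icc 0 T) v) : VanishesAtInfinity (u T - v T) := by
  obtain ⟨Ru, hRu⟩ := exists_norm_apply_le hu.1
  obtain ⟨Rv, hRv⟩ := exists_norm_apply_le hv.1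
  set R := max (max Ru Rv) 1
  have hR0 : 0 < R := lt_max_of_lt_right one_pos
  replace hRu : ∀ s ∈ Set.Icc 0 T, ∀ x, ‖(u s).1 x‖ ≤ R := fun s hs x =>
    (hRu s hs x).trans ((le_max_left _ _).trans (le_max_left _ _))
  replace hRv : ∀ s ∈ Set.Icc 0 T, ∀ x, ‖(v s).1 x‖ ≤ R := fun s hs x =>
    (hRv s hs x).trans ((le_max_right _ _).trans (le_max_left _ _))
  -- The Lipschitz hypothesis asks for a positive time horizon, while `T` may be zero.
  obtain ⟨L, hL, hLip⟩ := hFLip R hR0 (T + 1) (by positivity)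
  replace hLip : ∀ s ∈ Set.Icc 0 T, ∀ z z', ‖z‖ ≤ R → ‖z'‖ ≤ R →
      ‖F s z - F s z'‖ ≤ L * ‖z - z'‖ := fun s hs => hLip s ⟨hs.1, by linarith [hs.2]⟩
  -- Balls of `Z` need not be compact, so `F` is bounded on them through its values at `0` and the
  -- Lipschitz estimate.
  obtain ⟨K₀, hK₀⟩ := isCompact_Icc.exists_bound_of_continuousOn (s := Set.Icc 0 T)
    (f := fun s => F s 0) (hF.comp (f := fun s => (s, 0)) (by fun_prop)
      fun s hs => ⟨hs.1, trivial⟩)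
  set K := K₀ + L * R
  have hFK : ∀ s ∈ Set.Icc 0 T, ∀ z, ‖z‖ ≤ R → ‖F s z‖ ≤ K := fun s hs z hz => by
    have h := hLip s hs z 0 hz (by simpa using hR0.le)
    rw [sub_zero] at h
    calc ‖F s z‖ = ‖F s 0 + (F s z - F s 0)‖ := by abel_nf
      _ ≤ ‖F s 0‖ + ‖F s z - F s 0‖ := norm_add_le _ _
      _ ≤ K₀ + L * R := add_le_add (hK₀ s hs) (h.trans (by gcongr))
  have step : ∀ M, 0 ≤ M →
      (∀ s ∈ Set.Icc 0 T, LimsupNormLE (fun x => (u s).1 x - (v s).1 x) (M * exp (2 * L * s))) →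
      ∀ s ∈ Set.Icc 0 T,
        LimsupNormLE (fun x => (u s).1 x - (v s).1 x) (M / 2 * exp (2 * L * s)) := by
    intro M hM hP t ht
    have hsub : Set.Icc 0 t ⊆ Set.Icc 0 T := Set.Icc_subset_Icc_right ht.2
    exact limsupNormLE_sub_of_mild hσ h0 h1 hF hw₀ ht.1 (hu.mono hsub) (hv.mono hsub) hL.le hM
      (fun s hs x => hFK s (hsub hs) _ (hRu s (hsub hs) x))
      (fun s hs x => hFK s (hsub hs) _ (hRv s (hsub hs) x))
      (fun s hs x => hLip s (hsub hs) _ _ (hRu s (hsub hs) x) (hRv s (hsub hs) x))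
      fun s hs => hP s (hsub hs)
  -- The iteration starts from `R + R`, the trivial sup bound on the difference, since the weight is
  -- at least one.
  have hall : ∀ n : ℕ, ∀ s ∈ Set.Icc 0 T, LimsupNormLE (fun x => (u s).1 x - (v s).1 x)
      ((R + R) * (1 / 2) ^ n * exp (2 * L * s)) := by
    intro n
    induction n with
    | zero =>
      intro s hs
      refine LimsupNormLE.of_forall fun x => (norm_sub_le _ _).trans
        ((add_le_add (hRu s hs x) (hRv s hs x)).trans ?_)
      rw [pow_zero, mul_one]
      have : 0 ≤ s := hs.1
      exact le_mul_of_one_le_right (by positivity) (one_le_exp (by positivity))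
    | succ n ih =>
      have := step _ (by positivity) ih
      rwa [show (R + R) * (1 / 2) ^ (n + 1) = (R + R) * (1 / 2) ^ n / 2 by ring]
  have hz := limsupNormLE_zero_of_tendsto (B := fun n : ℕ =>
    (R + R) * (1 / 2) ^ n * exp (2 * L * T)) ?_ fun n => hall n T ⟨hT, le_rfl⟩
  · exact limsupNormLE_zero_iff.1 hz
  · have := ((tendsto_pow_atTop_nhds_zero_of_lt_one (r := (1 / 2 : ℝ)) (by norm_num)
      (by norm_num)).const_mul (R + R)).mul_const (exp (2 * L * T))
    simpa using this

theorem Icc_subset_timeInterval {t : ℝ} {S : ℝ≥0∞} (h : ENNReal.ofReal t < S) :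
    Set.Icc 0 t ⊆ timeInterval S :=
  fun _ hs => ⟨hs.1, (ENNReal.ofReal_le_ofReal hs.2).trans_lt h⟩

end MildSolution

end FracRD

theorem mainTheorem2 {Z : Type*} [NormedAddCommGroup Z] [NormedSpace ℝ Z] [CompleteSpace Z]
    (d : ℕ) (σ β : ℝ) (hσ : 0 ≤ σ) (hβ₀ : 0 < β) (hβ₁ : β ≤ 1)
    (F : ℝ → Z → Z)
    (hF : ContinuousOn (fun p : ℝ × Z => F p.1 p.2) (Set.Ici 0 ×ˢ Set.univ))
    (hFLip : FracRD.LocallyLipschitzSnd F)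
    (u₀ v₀ : FracRD.Cu d Z) (h₀ : FracRD.VanishesAtInfinity (u₀ - v₀))
    (u v : ℝ → FracRD.Cu d Z)
    (hu : FracRD.IsMildSolutionOn σ β F u₀
      (FracRD.timeInterval (FracRD.maximalTime σ β F u₀)) u)
    (hv : FracRD.IsMildSolutionOn σ β F v₀
      (FracRD.timeInterval (FracRD.maximalTime σ β F v₀)) v) :
    ∀ t : ℝ, 0 ≤ t →
      ENNReal.ofReal t < min (FracRD.maximalTime σ β F u₀) (FracRD.maximalTime σ β F v₀) →
      FracRD.VanishesAtInfinity (u t - v t) := by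

  intro t ht htT
  rw [lt_min_iff] at htT
  exact FracRD.vanishesAtInfinity_sub_of_mild hσ hβ₀ hβ₁ hF hFLip h₀ ht
    (hu.mono (FracRD.Icc_subset_timeInterval htT.1))
    (hv.mono (FracRD.Icc_subset_timeInterval htT.2))
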